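/- Let $\omega$ be a non-principal ultrafilter on $\mathbb N$, and let $\mathfrak U=\{(U(k_i),\|\cdot\|_i)\}_{i\in I}$ be a family of finite-dimensional unitary groups, where each $\|\cdot\|_i$ is a submultiplicative norm on the complex $k_i\times k_i$ matrices with $\|uAv\|_i=\|A\|_i$ for all $u,v\in U(k_i)$ and all $A$ (the same degree may occur several times, with different norms). For a group $G$ and maps $\varphi,\psi\colon G\to U(k_i)$ put $$\operatorname{def}(\varphi)=\sup_{g,h\in G}\|\varphi(gh)-\varphi(g)\varphi(h)\|_i,\qquad \operatorname{dist}(\varphi,\psi)=\sup_{g\in G}\|\varphi(g)-\psi(g)\|_i .$$ Say that $G$ is uniformly $\mathfrak U$-stable with a linear estimate if for every sequence of indices $(i_n)_{n\in\mathbb N}$ in $I$ and every sequence of maps $\varphi_n\colon G\to U(k_{i_n})$ with $\operatorname{def}(\varphi_n)\to 0$ there are homomorphisms $\psi_n\colon G\to U(k_{i_n})$ with $\operatorname{dist}(\varphi_n,\psi_n)=O_\omega(\operatorname{def}(\varphi_n))$, that is, there are a real constant $C$ and a set $S\in\omega$ such that $\operatorname{dist}(\varphi_n,\psi_n)\le C\operatorname{def}(\varphi_n)$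 for all $n\in S$. **Proposition 1.4.** Let $\Gamma$ be a countable discrete group and let $N$ be a normal subgroup of $\Gamma$ which is amenable, that is, which carries a left-invariant finitely additive probability measure defined on all its subsets. If $\Gamma$ is uniformly $\mathfrak U$-stable with a linear estimate, then so is $\Gamma/N$. -/

import Mathlib

open Filter Topology
open scoped Pointwise NNReal

/-- A submultiplicative norm on the complex `k × k` matrices which is bi-invariant under
multiplication by unitary matrices. The normalisation `‖1‖ = 1` is not required (the Frobenius norm
does not satisfy it). -/
structure UnitaryNorm (k : ℕ) extends Seminorm ℂ (Matrix (Fin k) (Fin k) ℂ) where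
  eq_zero_of_map_eq_zero : ∀ A, toFun A = 0 → A = 0
  map_mul_le : ∀ A B, toFun (A * B) ≤ toFun A * toFun B
  map_unitary_mul_mul : ∀ (u v : Matrix.unitaryGroup (Fin k) ℂ) (A : Matrix (Fin k) (Fin k) ℂ),
    toFun ((u : Matrix (Fin k) (Fin k) ℂ) * A * (v : Matrix (Fin k) (Fin k) ℂ)) = toFun A

/-- A family `{(U(kᵢ), ‖·‖ᵢ)}` of finite-dimensional unitary groups equipped with bi-invariant
submultiplicative norms. The same degree may occur many times, with different norms. -/
structure UnitaryFamily (ι : Type*) where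
  deg : ι → ℕ
  norm : ∀ i, UnitaryNorm (deg i)

/-- The `i`-th group `U(kᵢ)` of the family. -/
abbrev UnitaryFamily.U {ι : Type*} (𝔘 : UnitaryFamily ι) (i : ι) : Type :=
  Matrix.unitaryGroup (Fin (𝔘.deg i)) ℂ

/-- The distance `‖A - B‖` of two matrices in a given norm. -/
noncomputable def UnitaryNorm.distance {k : ℕ} (ν : UnitaryNorm k)
    (A B : Matrix.unitaryGroup (Fin k) ℂ) : ℝ :=
  ν.toSeminorm ((A : Matrix (Fin k) (Fin k) ℂ) - (B : Matrix (Fin k) (Fin k) ℂ))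

/-- By bi-invariance all unitary matrices have the norm of `1`, so distances are bounded and the
suprema below are those of bounded sets of reals. -/
theorem UnitaryNorm.distance_le {k : ℕ} (ν : UnitaryNorm k)
    (A B : Matrix.unitaryGroup (Fin k) ℂ) : ν.distance A B ≤ 2 * ν.toSeminorm 1 := by
  have key : ∀ C : Matrix.unitaryGroup (Fin k) ℂ,
      ν.toSeminorm (C : Matrix (Fin k) (Fin k) ℂ) = ν.toSeminorm 1 := fun C => by
    have h := ν.map_unitary_mul_mul C 1 1
    simp only [mul_one, OneMemClass.coe_one] at h
    exact h
  have h := map_sub_le_add ν.toSeminorm (A : Matrix (Fin k) (Fin k) ℂ)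
    (B : Matrix (Fin k) (Fin k) ℂ)
  rw [key, key] at h
  unfold UnitaryNorm.distance
  linarith

/-- The defect `sup_{g, h} ‖φ(gh) - φ(g)φ(h)‖` of a map `φ : G → U(k)`. -/
noncomputable def defect {G : Type*} [Group G] {k : ℕ} (ν : UnitaryNorm k)
    (φ : G → Matrix.unitaryGroup (Fin k) ℂ) : ℝ :=
  ⨆ p : G × G, ν.distance (φ (p.1 * p.2)) (φ p.1 * φ p.2)

/-- The uniform distance `sup_g ‖φ(g) - ψ(g)‖` of two maps `G → U(k)`. -/
noncomputable def uniformDist {G : Type*} {k : ℕ} (ν : UnitaryNorm k)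
    (φ ψ : G → Matrix.unitaryGroup (Fin k) ℂ) : ℝ :=
  ⨆ g : G, ν.distance (φ g) (ψ g)

/-- A uniform asymptotic homomorphism `G → 𝔘`: a sequence of maps `φₙ : G → U(k_{iₙ})` into members
of the family, with `def(φₙ) → 0`. -/
def IsUniformAsymptoticHom {G : Type*} [Group G] {ι : Type*} (𝔘 : UnitaryFamily ι)
    (i : ℕ → ι) (φ : ∀ n, G → 𝔘.U (i n)) : Prop :=
  Tendsto (fun n => defect (𝔘.norm (i n)) (φ n)) atTop (𝓝 0)

/-- `G` is uniformly `𝔘`-stable with a linear estimate: for every uniform asymptotic homomorphism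
`φ` there are homomorphisms `ψₙ` with the same ranges such that `dist(φₙ, ψₙ) = O_ω(def(φₙ))`, that
is, `dist(φₙ, ψₙ) ≤ C def(φₙ)` for some real `C` and `ω`-almost all `n`. -/
def IsUniformlyStableWithLinearEstimate (ω : Ultrafilter ℕ) (G : Type*) [Group G] {ι : Type*}
    (𝔘 : UnitaryFamily ι) : Prop :=
  ∀ (i : ℕ → ι) (φ : ∀ n, G → 𝔘.U (i n)), IsUniformAsymptoticHom 𝔘 i φ →
    ∃ ψ : ∀ n, G →* 𝔘.U (i n),
      (fun n => uniformDist (𝔘.norm (i n)) (φ n) (ψ n)) =O[(ω : Filter ℕ)]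
        (fun n => defect (𝔘.norm (i n)) (φ n))

/-- A discrete group is amenable if it carries a finitely additive, left invariant probability
measure defined on all subsets. -/
def IsAmenableGroup (G : Type*) [Group G] : Prop :=
  ∃ μ : Set G → ℝ≥0, μ Set.univ = 1 ∧
    (∀ A B : Set G, Disjoint A B → μ (A ∪ B) = μ A + μ B) ∧
    ∀ (g : G) (A : Set G), μ (g • A) = μ A

namespace UnitaryNorm

variable {k : ℕ} (ν : UnitaryNorm k)

/-! Pull `φₙ` back to `Γ`; surjectivity of the projection preserves the defect, so stability of `Γ`
gives homomorphisms `ψₙ` nearby. The pullback is constantly `φₙ(1)` on `N`, and `φₙ(1)` is within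
the defect of `1`, so `ψₙ(N)` lies in a small ball around `1`. Submultiplicativity excludes
nontrivial subgroups from balls of radius less than `1`, whatever the degree and the norm
(`map_eq_one_of_distance_le`). Hence `ψₙ` factors through `Γ ⧸ N` for `ω`-almost all `n`. -/

theorem map_mul (A B : Matrix (Fin k) (Fin k) ℂ) :
    ν.toSeminorm (A * B) ≤ ν.toSeminorm A * ν.toSeminorm B :=
  ν.map_mul_le A B

theorem map_unitary_mul (u : Matrix.unitaryGroup (Fin k) ℂ) (A : Matrix (Fin k) (Fin k) ℂ) :
    ν.toSeminorm ((u : Matrix (Fin k) (Fin k) ℂ) * A) = ν.toSeminorm A := by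
  have h := ν.map_unitary_mul_mul u 1 A
  simp only [mul_one, OneMemClass.coe_one] at h
  exact h

theorem distance_nonneg (A B : Matrix.unitaryGroup (Fin k) ℂ) : 0 ≤ ν.distance A B :=
  apply_nonneg _ _

theorem distance_comm (A B : Matrix.unitaryGroup (Fin k) ℂ) :
    ν.distance A B = ν.distance B A :=
  map_sub_rev _ _ _

theorem distance_triangle (A B C : Matrix.unitaryGroup (Fin k) ℂ) :
    ν.distance A C ≤ ν.distance A B + ν.distance B C := by
  have h := map_add_le_add ν.toSeminorm
    ((A : Matrix (Fin k) (Fin k) ℂ) - B) ((B : Matrix (Fin k) (Fin k) ℂ) - C)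
  rwa [sub_add_sub_cancel] at h

theorem distance_mul_left (u A B : Matrix.unitaryGroup (Fin k) ℂ) :
    ν.distance (u * A) (u * B) = ν.distance A B := by
  have h := ν.map_unitary_mul u ((A : Matrix (Fin k) (Fin k) ℂ) - B)
  rwa [mul_sub] at h

theorem eq_of_distance_eq_zero {A B : Matrix.unitaryGroup (Fin k) ℂ}
    (h : ν.distance A B = 0) : A = B :=
  Subtype.ext (sub_eq_zero.1 (ν.eq_zero_of_map_eq_zero _ h))

/-- The identity `2(u - 1) = (u² - 1) - (u - 1)²` in a submultiplicative norm. -/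
theorem two_mul_distance_one_le (u : Matrix.unitaryGroup (Fin k) ℂ) :
    2 * ν.distance u 1 ≤ ν.distance (u * u) 1 + ν.distance u 1 * ν.distance u 1 := by
  set A : Matrix (Fin k) (Fin k) ℂ := u.1
  have e : (2 : ℂ) • (A - 1) = (A * A - 1) - (A - 1) * (A - 1) := by
    rw [two_smul]; noncomm_ring
  have h₁ : 2 * ν.toSeminorm (A - 1) = ν.toSeminorm ((2 : ℂ) • (A - 1)) := by
    rw [map_smul_eq_mul]; norm_num
  have h₂ := map_sub_le_add ν.toSeminorm (A * A - 1) ((A - 1) * (A - 1))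
  rw [← e, ← h₁] at h₂
  exact h₂.trans (add_le_add le_rfl (ν.map_mul _ _))

/-- There are no non-trivial subgroups in a ball around `1` of radius less than `1`. -/
theorem map_eq_one_of_distance_le {H : Type*} [Group H]
    (ψ : H →* Matrix.unitaryGroup (Fin k) ℂ) {ε : ℝ} (hε : ε < 1)
    (h : ∀ x, ν.distance (ψ x) 1 ≤ ε) (x : H) : ψ x = 1 := by
  have hb : BddAbove (Set.range fun x => ν.distance (ψ x) 1) :=
    ⟨ε, Set.forall_mem_range.2 h⟩
  set s := ⨆ x, ν.distance (ψ x) 1 with hs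
  have hle : ∀ x, ν.distance (ψ x) 1 ≤ s := fun x => le_ciSup hb x
  have hs0 : 0 ≤ s := (ν.distance_nonneg _ _).trans (hle 1)
  have hs1 : s < 1 := (ciSup_le h).trans_lt hε
  -- Since `ψ(y)² = ψ(y²)` is again in the image, its distance to `1` is also at most `s`. This
  -- yields `s ≤ s²`, which forces `s = 0` because `0 ≤ s < 1`.
  have key : s ≤ (s + s * s) / 2 := ciSup_le fun y => by
    have h₁ := ν.two_mul_distance_one_le (ψ y)
    rw [← _root_.map_mul] at h₁
    have h₂ := mul_le_mul (hle y) (hle y) (ν.distance_nonneg _ _) hs0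
    linarith [hle (y * y)]
  have hz : s ≤ 0 := by nlinarith
  exact ν.eq_of_distance_eq_zero (le_antisymm ((hle x).trans hz) (ν.distance_nonneg _ _))

end UnitaryNorm

section Suprema

variable {G H : Type*} {k : ℕ} (ν : UnitaryNorm k)

theorem distance_le_uniformDist (φ ψ : G → Matrix.unitaryGroup (Fin k) ℂ) (g : G) :
    ν.distance (φ g) (ψ g) ≤ uniformDist ν φ ψ :=
  le_ciSup (f := fun g => ν.distance (φ g) (ψ g))
    ⟨_, Set.forall_mem_range.2 fun _ => ν.distance_le _ _⟩ g

theorem uniformDist_comp (φ ψ : G → Matrix.unitaryGroup (Fin k) ℂ) {f : H → G}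
    (hf : Function.Surjective f) : uniformDist ν (φ ∘ f) (ψ ∘ f) = uniformDist ν φ ψ :=
  hf.iSup_comp (g := fun g => ν.distance (φ g) (ψ g))

theorem distance_le_defect [Group G] (φ : G → Matrix.unitaryGroup (Fin k) ℂ) (g h : G) :
    ν.distance (φ (g * h)) (φ g * φ h) ≤ defect ν φ :=
  le_ciSup (f := fun p : G × G => ν.distance (φ (p.1 * p.2)) (φ p.1 * φ p.2))
    ⟨_, Set.forall_mem_range.2 fun _ => ν.distance_le _ _⟩ (g, h)

theorem defect_nonneg [Group G] (φ : G → Matrix.unitaryGroup (Fin k) ℂ) : 0 ≤ defect ν φ :=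
  Real.iSup_nonneg fun _ => ν.distance_nonneg _ _

/-- Compare `φ(1·1)` with `φ(1)φ(1)` and cancel one factor `φ(1)` by unitary invariance. -/
theorem distance_map_one_le_defect [Group G] (φ : G → Matrix.unitaryGroup (Fin k) ℂ) :
    ν.distance (φ 1) 1 ≤ defect ν φ := by
  have h := distance_le_defect ν φ 1 1
  rw [mul_one] at h
  nth_rewrite 1 [← mul_one (φ 1)] at h
  rwa [ν.distance_mul_left, ν.distance_comm] at h

theorem defect_comp [Group G] [Group H] (φ : G → Matrix.unitaryGroup (Fin k) ℂ) (f : H →* G)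
    (hf : Function.Surjective f) : defect ν (φ ∘ f) = defect ν φ := by
  have h := (hf.prodMap hf).iSup_comp
    (g := fun p : G × G => ν.distance (φ (p.1 * p.2)) (φ p.1 * φ p.2))
  simpa [defect] using h

/-- A homomorphism whose distance to a map pulled back from `G ⧸ N` is small compared with `1` is
trivial on `N`. -/
theorem le_ker_of_uniformDist_add_defect_lt_one [Group G] (N : Subgroup G) [N.Normal]
    (φ : G ⧸ N → Matrix.unitaryGroup (Fin k) ℂ) (ψ : G →* Matrix.unitaryGroup (Fin k) ℂ)
    (h : uniformDist ν (φ ∘ QuotientGroup.mk' N) ψ + defect ν φ < 1) : N ≤ ψ.ker := by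
  intro x hx
  refine ν.map_eq_one_of_distance_le (ψ.comp N.subtype) h (fun y => ?_) ⟨x, hx⟩
  have h₁ := distance_le_uniformDist ν (φ ∘ QuotientGroup.mk' N) ψ y
  have hy : QuotientGroup.mk' N (y : G) = 1 := (QuotientGroup.eq_one_iff _).2 y.2
  rw [Function.comp_apply, hy, ν.distance_comm] at h₁
  exact (ν.distance_triangle _ (φ 1) _).trans
    (add_le_add h₁ (distance_map_one_le_defect ν φ))

end Suprema

theorem proposition1p4 {Γ : Type*} [Group Γ] [Countable Γ] {ι : Type*} (𝔘 : UnitaryFamily ι)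
    (ω : Ultrafilter ℕ) (hω : (ω : Filter ℕ) ≤ Filter.cofinite)
    (N : Subgroup Γ) [N.Normal] (hN : IsAmenableGroup N)
    (hΓ : IsUniformlyStableWithLinearEstimate ω Γ 𝔘) :
    IsUniformlyStableWithLinearEstimate ω (Γ ⧸ N) 𝔘 := by
  classical
  intro i φ hφ
  have hπ := QuotientGroup.mk'_surjective N
  have hdef : ∀ n, defect (𝔘.norm (i n)) (φ n ∘ QuotientGroup.mk' N) =
      defect (𝔘.norm (i n)) (φ n) := fun n => defect_comp _ _ _ hπ
  obtain ⟨ψ, hψ⟩ := hΓ i (fun n => φ n ∘ QuotientGroup.mk' N)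
    (by simpa only [IsUniformAsymptoticHom, hdef] using hφ)
  simp only [hdef] at hψ
  -- Non-principality of `ω` turns an ordinary limit into a limit along `ω`.
  have hd : Tendsto (fun n => defect (𝔘.norm (i n)) (φ n)) ω (𝓝 0) :=
    hφ.mono_left (Nat.cofinite_eq_atTop ▸ hω)
  have hlt : ∀ᶠ n in (ω : Filter ℕ), uniformDist (𝔘.norm (i n)) (φ n ∘ QuotientGroup.mk' N) (ψ n) +
      defect (𝔘.norm (i n)) (φ n) < 1 := by
    have h := (hψ.trans_tendsto hd).add hd
    rw [add_zero] at h
    exact h.eventually_lt_const one_pos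
  -- The estimate only concerns `ω`-almost all `n`, so the trivial homomorphism serves wherever `ψ
  -- n` does not factor.
  refine ⟨fun n => if h : N ≤ (ψ n).ker then QuotientGroup.lift N (ψ n) h else 1,
    hψ.congr' ?_ EventuallyEq.rfl⟩
  filter_upwards [hlt] with n hn
  have hker := le_ker_of_uniformDist_add_defect_lt_one _ N (φ n) (ψ n) hn
  rw [dif_pos hker, ← uniformDist_comp _ (φ n) _ hπ]
  rfl
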